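/- Let $p\neq 2$ be a prime number, let $k$ be an uncountable algebraically closed field of characteristic $p$, and let $d\ge 0$ be an integer. For a Noetherian local ring $(S,\mathfrak m)$ of characteristic $p$, let $$e_{HK}(S)=\lim_{e\to\infty}\frac{\lambda\bigl(S/\mathfrak m^{[p^e]}\bigr)}{p^{e\dim S}}$$ denote its Hilbert--Kunz multiplicity, where $\lambda$ is length and $\mathfrak m^{[q]}$ is the ideal generated by the $q$-th powers of all elements of $\mathfrak m$. Let $f\in k[[x_0,\dots,x_d]]$ be a nonzero non-unit such that the $d$-dimensional hypersurface ring $R=k[[x_0,\dots,x_d]]/(f)$ is not a regular local ring. Then the limits defining both sides exist, and $$e_{HK}\Bigl(k[[x_0,\dots,x_d]]\big/\bigl(\textstyle\sum_{i=0}^{d}x_i^2\bigr)\Bigr)\;\le\; e_{HK}(R).$$ -/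

import Mathlib

open Filter Topology

/-- The `q`-th bracket power `I^[q] = (i ^ q : i ∈ I)` of an ideal; used for `q = p ^ e` in
characteristic `p`, where it is the Frobenius power. -/
def bracketPower {R : Type*} [CommRing R] (I : Ideal R) (q : ℕ) : Ideal R :=
  Ideal.span ((fun i : R => i ^ q) '' (I : Set R))

/-- The Krull dimension of a ring of finite Krull dimension (such as any Noetherian local ring)
as a natural number. -/
noncomputable def krullDimNat (R : Type*) [CommRing R] : ℕ :=
  ((ringKrullDim R).unbotD 0).toNat

/-- The normalized Hilbert-Kunz function `e ↦ λ(R / I^[q]) / q ^ (dim R)`, `q = p ^ e`. For a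
Noetherian local ring `R` and an ideal `I` primary to the maximal ideal, all these lengths are
finite. -/
noncomputable def hilbertKunzSeq (p : ℕ) {R : Type*} [CommRing R] (I : Ideal R) (e : ℕ) : ℝ :=
  ((Module.length R (R ⧸ bracketPower I (p ^ e))).toNat : ℝ) / ((p : ℝ) ^ e) ^ krullDimNat R

/-- The Hilbert-Kunz multiplicity `e_HK(I, R)`, the limit of `λ(R / I^[q]) / q ^ (dim R)` as
`q = p ^ e` tends to infinity. -/
noncomputable def hilbertKunzMultiplicityAt (p : ℕ) {R : Type*} [CommRing R] (I : Ideal R) : ℝ :=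
  limUnder atTop (hilbertKunzSeq p I)

/-- The Hilbert-Kunz multiplicity `e_HK(R)` of a local ring: that of its maximal ideal. -/
noncomputable def hilbertKunzMultiplicity (p : ℕ) (R : Type*) [CommRing R] [IsLocalRing R] : ℝ :=
  hilbertKunzMultiplicityAt p (IsLocalRing.maximalIdeal R)

/-- The defining sequence of `e_HK(R)` converges, so that `hilbertKunzMultiplicity p R` is
its limit and not a default value. -/
def HilbertKunzLimitExists (p : ℕ) (R : Type*) [CommRing R] [IsLocalRing R] : Prop :=
  Tendsto (hilbertKunzSeq p (IsLocalRing.maximalIdeal R)) atTop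
    (𝓝 (hilbertKunzMultiplicity p R))

/-- The ring `k[[x_0, …, x_d]] / (f)`. -/
abbrev HypersurfaceRing {k : Type*} [Field k] {d : ℕ} (f : MvPowerSeries (Fin (d + 1)) k) :
    Type _ :=
  MvPowerSeries (Fin (d + 1)) k ⧸ Ideal.span {f}

/-- The quadratic form `x_0 ^ 2 + ⋯ + x_d ^ 2`. -/
noncomputable def sumOfSquares (k : Type*) [Field k] (d : ℕ) : MvPowerSeries (Fin (d + 1)) k :=
  ∑ i : Fin (d + 1), MvPowerSeries.X i ^ 2

theorem not_isUnit_sumOfSquares (k : Type*) [Field k] (d : ℕ) :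
    ¬ IsUnit (sumOfSquares k d) := by
  rw [MvPowerSeries.isUnit_iff_constantCoeff]
  simp [sumOfSquares]

instance isLocalRing_sumOfSquares (k : Type*) [Field k] (d : ℕ) :
    IsLocalRing (HypersurfaceRing (sumOfSquares k d)) := by
  have : Nontrivial (HypersurfaceRing (sumOfSquares k d)) := by
    rw [Ideal.Quotient.nontrivial_iff, Ne, Ideal.span_singleton_eq_top]
    exact not_isUnit_sumOfSquares k d
  exact IsLocalRing.of_surjective' (Ideal.Quotient.mk _) Ideal.Quotient.mk_surjective

/-! The inequality already holds for every `q = p ^ e`, before any limit. Set `A = k[[x]]/(x_i ^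
q)`, which is finite-dimensional over `k`. The length of `R/m^[q]` is then the dimension of `A/(f)`,
that is, the nullity of multiplication by `f` on `A`.

Singularity puts `f` in the square of the maximal ideal, so `f = ∑ a_ij x_i x_j`, with `a` symmetric
after averaging since `2` is invertible. Let `g = ∑ x_i ^ 2`. For all but finitely many `s` in `k`,
the quadratic part of `f + s g` is nondegenerate and multiplication by `f + s g` on `A` has rank at
least that of `f`. The scalar `s` may depend on `e`, as the comparison is made at each level
separately (`truncColength_sum_sq_le`).

A nondegenerate `f + s g` has the same colength as `g`: its matrix factors over `A` as `Eᵀ E` with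
`E` invertible, so it is the sum of squares of `y = E x`. Frobenius additivity gives `y_i ^ q = 0`,
hence `x_i ↦ y_i` is an automorphism of `A` (`truncColength_sum_sq_eq`).

The limits exist because the normalized colengths increase, by a Frobenius rank count
(`pow_mul_truncColength_le`), and are bounded, by a lexicographic initial term argument
(`exists_truncColength_le`). -/

open MvPowerSeries in
/-- The ideal `(X_i ^ q)` of a power series ring. -/
noncomputable def varPowIdeal (k : Type*) [Field k] (n q : ℕ) : Ideal (MvPowerSeries (Fin n) k) :=
  Ideal.span (Set.range fun i => X i ^ q)

/-! ### The truncated power series rings and their monomial bases. -/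

section VarPowIdeal

variable {k : Type*} [Field k] {n : ℕ}

open MvPowerSeries

theorem mem_varPowIdeal_iff {q : ℕ} {f : MvPowerSeries (Fin n) k} :
    f ∈ varPowIdeal k n q ↔ ∀ m : Fin n →₀ ℕ, (∀ i, m i < q) → coeff m f = 0 := by
  classical
  constructor
  · intro hf m hm
    obtain ⟨c, rfl⟩ := Ideal.mem_span_range_iff_exists_fun.1 hf
    rw [map_sum]
    refine Finset.sum_eq_zero fun i _ => ?_
    exact X_pow_dvd_iff.1 (Dvd.intro_left _ rfl) m (hm i)
  · intro h
    -- Each surviving monomial goes to the first variable with exponent at least `q`, so that none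
    -- is counted twice.
    let g : Fin n → MvPowerSeries (Fin n) k := fun i m =>
      if q ≤ m i ∧ ∀ j < i, m j < q then f m else 0
    have hg : ∀ i m, coeff m (g i) = if q ≤ m i ∧ ∀ j < i, m j < q then coeff m f else 0 :=
      fun i m => rfl
    have hfg : f = ∑ i, g i := by
      ext m
      rw [map_sum]
      simp only [hg]
      by_cases hm : ∀ i, m i < q
      · rw [h m hm]; simp
      · push Not at hm
        obtain ⟨i, hi, hmin⟩ : ∃ i, q ≤ m i ∧ ∀ j < i, m j < q := by
          have hne : (Finset.univ.filter fun i => q ≤ m i).Nonempty := by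
            obtain ⟨i, hi⟩ := hm
            exact ⟨i, by simpa using hi⟩
          refine ⟨_, (Finset.mem_filter.1 (Finset.min'_mem _ hne)).2, fun j hj => ?_⟩
          by_contra hjq
          exact absurd (Finset.min'_le _ j (by simpa using hjq)) (not_le.2 hj)
        rw [Finset.sum_eq_single i, if_pos ⟨hi, hmin⟩]
        · intro j _ hji
          refine if_neg fun ⟨hj, hjm⟩ => ?_
          rcases lt_or_gt_of_ne hji with hlt | hlt
          · exact absurd (hmin j hlt) (not_lt.2 hj)
          · exact absurd (hjm i hlt) (not_lt.2 hi)
        · simp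
    rw [hfg]
    refine Ideal.sum_mem _ fun i _ => ?_
    have : (X i : MvPowerSeries (Fin n) k) ^ q ∣ g i :=
      X_pow_dvd_iff.2 fun m hm => by rw [hg, if_neg]; exact fun h => absurd h.1 (not_le.2 hm)
    exact Ideal.mem_of_dvd _ this (Ideal.subset_span ⟨i, rfl⟩)

theorem varPowIdeal_one : varPowIdeal k n 1 = Ideal.span (Set.range X) := by
  simp [varPowIdeal]

theorem maximalIdeal_eq_span_X :
    IsLocalRing.maximalIdeal (MvPowerSeries (Fin n) k) = Ideal.span (Set.range X) := by
  rw [← varPowIdeal_one]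
  ext f
  rw [IsLocalRing.mem_maximalIdeal, mem_nonunits_iff, isUnit_iff_constantCoeff, isUnit_iff_ne_zero,
    not_not, mem_varPowIdeal_iff]
  simp only [Nat.lt_one_iff]
  constructor
  · intro h m hm
    rwa [show m = 0 from Finsupp.ext hm, coeff_zero_eq_constantCoeff_apply]
  · intro h
    rw [← coeff_zero_eq_constantCoeff_apply]
    exact h 0 (by simp)

theorem mem_maximalIdeal_iff_constantCoeff {f : MvPowerSeries (Fin n) k} :
    f ∈ IsLocalRing.maximalIdeal (MvPowerSeries (Fin n) k) ↔ constantCoeff f = 0 := by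
  rw [IsLocalRing.mem_maximalIdeal, mem_nonunits_iff, isUnit_iff_constantCoeff, isUnit_iff_ne_zero,
    not_not]

/-- The truncated ring `k[[X_0, …]] / (X_i ^ q)`. -/
abbrev TruncRing (k : Type*) [Field k] (n q : ℕ) : Type _ :=
  MvPowerSeries (Fin n) k ⧸ varPowIdeal k n q

/-- The coefficients at the monomials with all exponents less than `q`. -/
noncomputable def boxCoeff (k : Type*) [Field k] (n q : ℕ) :
    MvPowerSeries (Fin n) k →ₗ[k] ((Fin n → Fin q) → k) :=
  LinearMap.pi fun m => coeff (Finsupp.equivFunOnFinite.symm fun i => (m i : ℕ))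

theorem ker_boxCoeff (q : ℕ) :
    LinearMap.ker (boxCoeff k n q) = (varPowIdeal k n q).restrictScalars k := by
  ext f
  rw [LinearMap.mem_ker, Submodule.restrictScalars_mem, mem_varPowIdeal_iff, funext_iff]
  constructor
  · intro h m hm
    have h1 := h fun i => ⟨m i, hm i⟩
    simp only [boxCoeff, LinearMap.pi_apply, Pi.zero_apply] at h1
    rwa [show (Finsupp.equivFunOnFinite.symm fun i => m i) = m from
      Finsupp.equivFunOnFinite.symm_apply_apply m] at h1
  · intro h m
    exact h _ fun i => by simp

theorem boxCoeff_surjective (q : ℕ) : Function.Surjective (boxCoeff k n q) := by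
  classical
  intro v
  let g : MvPowerSeries (Fin n) k := fun m => if h : ∀ i, m i < q then v fun i => ⟨m i, h i⟩ else 0
  have hg : ∀ m, coeff m g = if h : ∀ i, m i < q then v fun i => ⟨m i, h i⟩ else 0 := fun _ => rfl
  refine ⟨g, funext fun m => (hg _).trans ?_⟩
  simp

/-- The monomial coordinates on the truncated ring. -/
noncomputable def truncRingEquiv (k : Type*) [Field k] (n q : ℕ) :
    TruncRing k n q ≃ₗ[k] ((Fin n → Fin q) → k) :=
  (Submodule.quotEquivOfEq _ _ (ker_boxCoeff q).symm : _ ≃ₗ[k] _).trans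
    ((boxCoeff k n q).quotKerEquivOfSurjective (boxCoeff_surjective q))

instance finite_truncRing (q : ℕ) : Module.Finite k (TruncRing k n q) :=
  Module.Finite.equiv (truncRingEquiv k n q).symm

theorem finrank_truncRing (q : ℕ) : Module.finrank k (TruncRing k n q) = q ^ n := by
  rw [(truncRingEquiv k n q).finrank_eq]
  simp

/-- The `n` variables generate the maximal ideal, and each adjoined power series variable raises the
dimension by at least one. -/
theorem ringKrullDim_mvPowerSeries_fin (k : Type*) [Field k] (n : ℕ) :
    ringKrullDim (MvPowerSeries (Fin n) k) = n := by
  apply le_antisymm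
  · refine (ringKrullDim_le_spanFinrank_maximalIdeal _).trans ?_
    rw [maximalIdeal_eq_span_X]
    have := Submodule.spanFinrank_span_le_ncard_of_finite
      (R := MvPowerSeries (Fin n) k) (Set.finite_range (X : Fin n → MvPowerSeries (Fin n) k))
    have h2 : (Set.range (X : Fin n → MvPowerSeries (Fin n) k)).ncard ≤ n := by
      rw [← Set.image_univ]
      exact (Set.ncard_image_le Set.finite_univ).trans (by simp [Set.ncard_univ])
    exact_mod_cast this.trans h2
  · induction n with
    | zero => exact_mod_cast ringKrullDim_nonneg_of_nontrivial
    | succ n ih =>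
      rw [ringKrullDim_eq_of_ringEquiv (finSuccEquiv k n).toRingEquiv]
      refine le_trans ?_ ringKrullDim_succ_le_ringKrullDim_powerseries
      push_cast
      gcongr

end VarPowIdeal

/-! ### From Hilbert–Kunz lengths to vector space dimensions; equations of singular hypersurfaces.
-/

section Length

variable {k : Type*} [Field k] {n : ℕ}

open MvPowerSeries IsLocalRing

theorem bracketPower_pow_eq_map {R : Type*} [CommRing R] (p : ℕ) [Fact p.Prime] [CharP R p]
    (I : Ideal R) (e : ℕ) : bracketPower I (p ^ e) = I.map (iterateFrobenius R p e) := by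
  rw [bracketPower, Ideal.map]
  congr 1

theorem maximalIdeal_hypersurface (f : MvPowerSeries (Fin n) k)
    [IsLocalRing (MvPowerSeries (Fin n) k ⧸ Ideal.span {f})] :
    maximalIdeal (MvPowerSeries (Fin n) k ⧸ Ideal.span {f}) =
      Ideal.span (Set.range fun i => Ideal.Quotient.mk (Ideal.span {f}) (X i)) := by
  rw [← IsLocalRing.map_maximalIdeal_of_surjective _
      (Ideal.Quotient.mk_surjective (I := Ideal.span {f})),
    maximalIdeal_eq_span_X, Ideal.map_span, ← Set.range_comp]
  rfl

theorem bracketPower_maximalIdeal_hypersurface (p : ℕ) [Fact p.Prime] [CharP k p]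
    (f : MvPowerSeries (Fin n) k) [IsLocalRing (MvPowerSeries (Fin n) k ⧸ Ideal.span {f})] (e : ℕ) :
    bracketPower (maximalIdeal (MvPowerSeries (Fin n) k ⧸ Ideal.span {f})) (p ^ e) =
      (varPowIdeal k n (p ^ e)).map (Ideal.Quotient.mk (Ideal.span {f})) := by
  have : CharP (MvPowerSeries (Fin n) k ⧸ Ideal.span {f}) p :=
    charP_of_injective_algebraMap
      (algebraMap k (MvPowerSeries (Fin n) k ⧸ Ideal.span {f})).injective p
  rw [bracketPower_pow_eq_map, maximalIdeal_hypersurface, varPowIdeal, Ideal.map_span,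
    Ideal.map_span, ← Set.range_comp, ← Set.range_comp]
  rfl

theorem residue_algebraMap_surjective (f : MvPowerSeries (Fin n) k)
    [IsLocalRing (MvPowerSeries (Fin n) k ⧸ Ideal.span {f})] :
    Function.Surjective (algebraMap (ResidueField k)
      (ResidueField (MvPowerSeries (Fin n) k ⧸ Ideal.span {f}))) := by
  intro x
  obtain ⟨y, rfl⟩ := residue_surjective x
  obtain ⟨g, rfl⟩ := Ideal.Quotient.mk_surjective y
  refine ⟨residue k (constantCoeff g), ?_⟩
  rw [ResidueField.algebraMap_residue, ← sub_eq_zero, ← map_sub, residue_eq_zero_iff,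
    maximalIdeal_hypersurface]
  have h : C (constantCoeff g) - g ∈ Ideal.span (Set.range (X (R := k) (σ := Fin n))) := by
    rw [← maximalIdeal_eq_span_X, mem_maximalIdeal_iff_constantCoeff]
    simp
  have h2 := Ideal.mem_map_of_mem (Ideal.Quotient.mk (Ideal.span {f})) h
  rw [Ideal.map_span, ← Set.range_comp] at h2
  exact h2

/-- The residue field of the hypersurface ring is that of `k`, so length over the ring is dimension
over `k`; the two successive quotients commute. -/
theorem length_quotient_bracketPower (p : ℕ) [Fact p.Prime] [CharP k p]
    (f : MvPowerSeries (Fin n) k) [IsLocalRing (MvPowerSeries (Fin n) k ⧸ Ideal.span {f})] (e : ℕ) :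
    Module.length (MvPowerSeries (Fin n) k ⧸ Ideal.span {f})
      ((MvPowerSeries (Fin n) k ⧸ Ideal.span {f}) ⧸
        bracketPower (maximalIdeal (MvPowerSeries (Fin n) k ⧸ Ideal.span {f})) (p ^ e)) =
      Module.finrank k (TruncRing k n (p ^ e) ⧸
        Ideal.span {Ideal.Quotient.mk (varPowIdeal k n (p ^ e)) f}) := by
  rw [bracketPower_maximalIdeal_hypersurface]
  have key := IsLocalRing.length_restrictScalars k (MvPowerSeries (Fin n) k ⧸ Ideal.span {f})
    ((MvPowerSeries (Fin n) k ⧸ Ideal.span {f}) ⧸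
        (varPowIdeal k n (p ^ e)).map (Ideal.Quotient.mk (Ideal.span {f})))
  rw [Module.length_eq_of_surjective (S := ResidueField k)
    (R := ResidueField (MvPowerSeries (Fin n) k ⧸ Ideal.span {f}))
    (M := ResidueField (MvPowerSeries (Fin n) k ⧸ Ideal.span {f}))
    (residue_algebraMap_surjective f),
    Module.length_eq_one (ResidueField (MvPowerSeries (Fin n) k ⧸ Ideal.span {f}))
      (ResidueField (MvPowerSeries (Fin n) k ⧸ Ideal.span {f})), mul_one] at key
  rw [← key]
  have E := (DoubleQuot.quotQuotEquivCommₐ k (Ideal.span {f}) (varPowIdeal k n (p ^ e))).toLinearEquiv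
  have h : (Ideal.span {f}).map (Ideal.Quotient.mk (varPowIdeal k n (p ^ e))) =
      Ideal.span {Ideal.Quotient.mk (varPowIdeal k n (p ^ e)) f} := by
    rw [Ideal.map_span, Set.image_singleton]
  have E2 : _ ≃ₗ[k] (TruncRing k n (p ^ e) ⧸
        Ideal.span {Ideal.Quotient.mk (varPowIdeal k n (p ^ e)) f}) :=
    E.trans (Ideal.quotientEquivAlgOfEq k h).toLinearEquiv
  rw [← Module.length_eq_finrank]
  exact E2.length_eq

theorem ringKrullDim_hypersurface {d : ℕ} {f : MvPowerSeries (Fin (d + 1)) k} (hf : f ≠ 0)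
    (hfm : f ∈ maximalIdeal (MvPowerSeries (Fin (d + 1)) k)) :
    ringKrullDim (MvPowerSeries (Fin (d + 1)) k ⧸ Ideal.span {f}) = d := by
  have h := ringKrullDim_quotient_span_singleton_succ_eq_ringKrullDim_of_mem_nonZeroDivisors
    (mem_nonZeroDivisors_of_ne_zero hf) hfm
  rw [ringKrullDim_mvPowerSeries_fin] at h
  push_cast at h
  obtain ⟨m, hm⟩ : ∃ m : ℕ∞, ringKrullDim (MvPowerSeries (Fin (d + 1)) k ⧸ Ideal.span {f}) = m :=
    (WithBot.ne_bot_iff_exists.1 fun h0 => by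
      rw [h0, WithBot.bot_add] at h
      exact WithBot.bot_ne_coe h).imp fun _ h => h.symm
  rw [hm] at h ⊢
  have h' : m + 1 = (d : ℕ∞) + 1 := by exact_mod_cast h
  exact_mod_cast (ENat.add_left_injective_of_ne_top ENat.one_ne_top) h'

theorem krullDimNat_hypersurface {d : ℕ} {f : MvPowerSeries (Fin (d + 1)) k} (hf : f ≠ 0)
    (hfm : f ∈ maximalIdeal (MvPowerSeries (Fin (d + 1)) k)) :
    krullDimNat (MvPowerSeries (Fin (d + 1)) k ⧸ Ideal.span {f}) = d := by
  rw [krullDimNat, ringKrullDim_hypersurface hf hfm]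
  rfl

theorem hypersurface_mem_maximalIdeal {f : MvPowerSeries (Fin n) k}
    [IsLocalRing (MvPowerSeries (Fin n) k ⧸ Ideal.span {f})] :
    f ∈ maximalIdeal (MvPowerSeries (Fin n) k) := by
  rw [mem_maximalIdeal, mem_nonunits_iff, ← Ideal.span_singleton_eq_top]
  exact Ideal.Quotient.nontrivial_iff.1 inferInstance

/-- A hypersurface whose equation has a nonzero linear part is regular. -/
theorem isRegularLocalRing_hypersurface {d : ℕ} {f : MvPowerSeries (Fin (d + 1)) k} (hf : f ≠ 0)
    [IsLocalRing (HypersurfaceRing f)] (c : Fin (d + 1) → MvPowerSeries (Fin (d + 1)) k)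
    (hc : f = ∑ i, c i * X i) {j : Fin (d + 1)} (hj : IsUnit (c j)) :
    IsRegularLocalRing (HypersurfaceRing f) := by
  classical
  apply IsRegularLocalRing.of_spanFinrank_maximalIdeal_le
  rw [ringKrullDim_hypersurface hf hypersurface_mem_maximalIdeal, maximalIdeal_hypersurface]
  let x : Fin (d + 1) → HypersurfaceRing f := fun i => Ideal.Quotient.mk _ (X i)
  -- Since `c j` is a unit, the relation `f = 0` expresses `x j` through the other `d` variables.
  have hspan : Ideal.span (Set.range x) = Ideal.span (Set.range fun i => x (j.succAbove i)) := by
    apply le_antisymm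
    · rw [Ideal.span_le]
      rintro _ ⟨i, rfl⟩
      by_cases hij : i = j
      · subst hij
        obtain ⟨u, hu⟩ := hj
        have h0 : (∑ l, Ideal.Quotient.mk (Ideal.span {f}) (c l) * x l) = 0 := by
          have : Ideal.Quotient.mk (Ideal.span {f}) f = 0 :=
            Ideal.Quotient.eq_zero_iff_mem.2 (Ideal.mem_span_singleton_self f)
          rw [congrArg (Ideal.Quotient.mk (Ideal.span {f})) hc, map_sum] at this
          simpa [x] using this
        rw [Fin.sum_univ_succAbove _ i, ← hu] at h0
        have h1 : x i = - (Ideal.Quotient.mk (Ideal.span {f}) (↑u⁻¹) *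
            ∑ l, Ideal.Quotient.mk (Ideal.span {f}) (c (i.succAbove l)) * x (i.succAbove l)) := by
          rw [← eq_neg_iff_add_eq_zero.2 h0 |> neg_eq_iff_eq_neg.2, mul_neg, neg_neg, ← mul_assoc,
            ← map_mul]
          simp
        rw [SetLike.mem_coe, h1]
        refine neg_mem (Ideal.mul_mem_left _ _ (Ideal.sum_mem _ fun l _ =>
          Ideal.mul_mem_left _ _ (Ideal.subset_span ⟨l, rfl⟩)))
      · obtain ⟨l, rfl⟩ := Fin.exists_succAbove_eq hij
        exact Ideal.subset_span ⟨l, rfl⟩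
    · exact Ideal.span_mono (by rintro _ ⟨l, rfl⟩; exact ⟨_, rfl⟩)
  change ((Submodule.spanFinrank (Ideal.span (Set.range x)) : ℕ) : WithBot ℕ∞) ≤ _
  rw [hspan]
  have := Submodule.spanFinrank_span_le_ncard_of_finite
    (R := HypersurfaceRing f) (Set.finite_range fun i => x (j.succAbove i))
  have h2 : (Set.range fun i => x (j.succAbove i)).ncard ≤ d := by
    rw [← Set.image_univ]
    exact (Set.ncard_image_le Set.finite_univ).trans (by simp [Set.ncard_univ])
  exact_mod_cast this.trans h2

/-- The equation of a singular hypersurface is a quadratic expression in the variables. -/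
theorem exists_eq_sum_mul_X_mul_X {d : ℕ} {f : MvPowerSeries (Fin (d + 1)) k} (hf : f ≠ 0)
    [IsLocalRing (HypersurfaceRing f)] (hsing : ¬ IsRegularLocalRing (HypersurfaceRing f)) :
    ∃ a : Matrix (Fin (d + 1)) (Fin (d + 1)) (MvPowerSeries (Fin (d + 1)) k),
      f = ∑ i, ∑ j, a i j * X i * X j := by
  have hfm := hypersurface_mem_maximalIdeal (f := f)
  rw [maximalIdeal_eq_span_X] at hfm
  obtain ⟨c, hc⟩ := Ideal.mem_span_range_iff_exists_fun.1 hfm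
  have h : ∀ i, ∃ a : Fin (d + 1) → MvPowerSeries (Fin (d + 1)) k, ∑ j, a j * X j = c i := by
    intro i
    rw [← Ideal.mem_span_range_iff_exists_fun, ← maximalIdeal_eq_span_X, mem_maximalIdeal,
      mem_nonunits_iff]
    exact fun hi => hsing (isRegularLocalRing_hypersurface hf c hc.symm hi)
  choose a ha using h
  refine ⟨a, ?_⟩
  rw [← hc]
  refine Finset.sum_congr rfl fun i _ => ?_
  rw [← ha, Finset.sum_mul]
  exact Finset.sum_congr rfl fun j _ => by ring

end Length

/-! ### Colength of a principal ideal as a nullity. -/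

section Colength

variable {k A : Type*} [Field k] [CommRing A] [Algebra k A] [Module.Finite k A]

/-- The dimension of `A / (a)` for a finite-dimensional algebra `A`. -/
noncomputable def colength (k : Type*) {A : Type*} [Field k] [CommRing A] [Algebra k A]
    (a : A) : ℕ :=
  Module.finrank k (A ⧸ Ideal.span {a})

omit [Module.Finite k A] in
theorem range_mulLeft (a : A) :
    LinearMap.range (LinearMap.mulLeft k a) = (Ideal.span {a}).restrictScalars k := by
  ext x
  simp [Ideal.mem_span_singleton', mul_comm]

theorem colength_add_finrank_range (a : A) :
    colength k a + Module.finrank k (LinearMap.range (LinearMap.mulLeft k a)) =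
      Module.finrank k A := by
  rw [range_mulLeft]
  exact ((Ideal.span {a}).restrictScalars k).finrank_quotient_add_finrank

theorem colength_eq_finrank_ker (a : A) :
    colength k a = Module.finrank k (LinearMap.ker (LinearMap.mulLeft k a)) := by
  have h1 := colength_add_finrank_range (k := k) a
  have h2 := (LinearMap.mulLeft k a).finrank_range_add_finrank_ker
  omega

/-- Multiplication by `b` maps the annihilator of `a * b` into that of `a`, and its kernel there
lies in the annihilator of `b`. -/
theorem colength_mul_le (a b : A) : colength k (a * b) ≤ colength k a + colength k b := by
  rw [colength_eq_finrank_ker, colength_eq_finrank_ker, colength_eq_finrank_ker]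
  let M : LinearMap.ker (LinearMap.mulLeft k (a * b)) →ₗ[k] LinearMap.ker (LinearMap.mulLeft k a) :=
    (LinearMap.mulLeft k b).restrict fun x hx => by
      simpa [mul_assoc] using hx
  rw [← M.finrank_range_add_finrank_ker]
  refine add_le_add (Submodule.finrank_le _) ?_
  let ι : LinearMap.ker M →ₗ[k] LinearMap.ker (LinearMap.mulLeft k b) :=
    ((LinearMap.ker (LinearMap.mulLeft k (a * b))).subtype.comp (LinearMap.ker M).subtype).codRestrict
      _ fun x => by
        have := congrArg Subtype.val (LinearMap.mem_ker.1 x.2)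
        exact LinearMap.mem_ker.2 this
  refine LinearMap.finrank_le_finrank_of_injective (f := ι) fun x y hxy => ?_
  have := congrArg Subtype.val hxy
  exact Subtype.ext (Subtype.ext this)

theorem colength_pow_le (a : A) (m : ℕ) : colength k (a ^ m) ≤ m * colength k a := by
  induction m with
  | zero =>
    rw [pow_zero, colength_eq_finrank_ker, LinearMap.mulLeft_one, LinearMap.ker_id]
    simp
  | succ m ih =>
    rw [pow_succ, add_mul, one_mul]
    exact (colength_mul_le _ _).trans (by omega)

omit [Module.Finite k A] in
theorem colength_algEquiv {B : Type*} [CommRing B] [Algebra k B] (e : A ≃ₐ[k] B) (a : A) :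
    colength k (e a) = colength k a :=
  (Ideal.quotientEquivAlg (Ideal.span {a}) (Ideal.span {e a}) e
    (by rw [Ideal.map_span, Set.image_singleton]; rfl)).toLinearEquiv.finrank_eq.symm

end Colength

/-! ### Semicontinuity of rank in a pencil of endomorphisms. -/

section Semicontinuity

variable {k V : Type*} [Field k] [AddCommGroup V] [Module k V] [Module.Finite k V]

/-- A nonzero kernel vector of `id + s N` is an eigenvector of `N` for `-s⁻¹`, and `N` has finitely
many eigenvalues. -/
theorem finite_setOf_not_injective_id_add_smul (N : Module.End k V) :
    {s : k | ¬ Function.Injective ((LinearMap.id : V →ₗ[k] V) + s • N)}.Finite := by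
  refine (N.finite_hasEigenvalue.image fun μ => -μ⁻¹).subset fun s hs => ?_
  rw [Set.mem_ofPred_eq, injective_iff_map_eq_zero] at hs
  push Not at hs
  obtain ⟨w, hw, hw0⟩ := hs
  have hs0 : s ≠ 0 := by
    rintro rfl
    exact hw0 (by simpa using hw)
  refine ⟨-s⁻¹, ?_, by simp⟩
  refine Module.End.hasEigenvalue_of_hasEigenvector (x := w) ⟨?_, hw0⟩
  rw [Module.End.mem_eigenspace_iff, eq_comm, neg_smul, neg_eq_iff_eq_neg,
    inv_smul_eq_iff₀ hs0, smul_neg,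
    ← add_eq_zero_iff_eq_neg]
  simpa using hw

/-- Lower semicontinuity of the rank along a line. -/
theorem finite_setOf_finrank_range_add_smul_lt (L M : Module.End k V) :
    {s : k | Module.finrank k (LinearMap.range (L + s • M)) <
      Module.finrank k (LinearMap.range L)}.Finite := by
  -- With `v` a section of `L` and `π` a retraction onto its range, `π (L + s M) v = id + s π M v`
  -- on that range. Where this is injective, `L + s M` has rank at least that of `L`.
  obtain ⟨v, hv⟩ := L.rangeRestrict.exists_rightInverse_of_surjective L.range_rangeRestrict
  obtain ⟨π, hπ⟩ := (LinearMap.range L).subtype.exists_leftInverse_of_injective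
    (LinearMap.range L).ker_subtype
  refine (finite_setOf_not_injective_id_add_smul (π ∘ₗ M ∘ₗ v)).subset fun s hs hinj => ?_
  rw [Set.mem_ofPred_eq] at hs
  refine absurd hs (not_lt.2 ?_)
  have hL : π ∘ₗ L ∘ₗ v = LinearMap.id := by
    refine LinearMap.ext fun w => ?_
    have h1 : L (v w) = w := congrArg Subtype.val (LinearMap.congr_fun hv w)
    rw [LinearMap.comp_apply, LinearMap.comp_apply, h1]
    exact LinearMap.congr_fun hπ w
  have hT : LinearMap.id + s • (π ∘ₗ M ∘ₗ v) = π ∘ₗ (L + s • M) ∘ₗ v := by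
    rw [← hL]
    ext x
    simp
  rw [hT] at hinj
  have h1 : Function.Injective ((L + s • M) ∘ₗ v) := Function.Injective.of_comp (f := π) hinj
  rw [← LinearMap.finrank_range_of_inj h1]
  exact Submodule.finrank_mono (LinearMap.range_comp_le_range _ _)

end Semicontinuity

/-! ### Diagonalizing quadratic expressions modulo a nilpotent ideal. -/

section Morse

open Matrix

variable {k : Type*} [Field k] {n : ℕ}

/-- Nondegenerate quadratic forms of equal rank over an algebraically closed field with `2 ≠ 0` are
isometric; `P` is the matrix of an isometry to the standard form. -/
theorem exists_transpose_mul_self_eq [IsAlgClosed k] (h2 : (2 : k) ≠ 0)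
    (b : Matrix (Fin n) (Fin n) k) (hb : b.IsSymm) (hdet : b.det ≠ 0) :
    ∃ P : Matrix (Fin n) (Fin n) k, Pᵀ * P = b := by
  have : Invertible (2 : k) := invertibleOfNonzero h2
  let Q : ∀ _ : Matrix (Fin n) (Fin n) k, QuadraticForm k (Fin n → k) := fun c =>
    c.toQuadraticForm'
  have hassoc : ∀ c : Matrix (Fin n) (Fin n) k, c.IsSymm →
      QuadraticMap.associated (Q c) = Matrix.toLinearMap₂' k c := by
    intro c hc
    apply QuadraticMap.associated_left_inverse
    intro v w
    rw [Matrix.toLinearMap₂'_apply', Matrix.toLinearMap₂'_apply', Matrix.dotProduct_mulVec,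
      dotProduct_comm, ← Matrix.mulVec_transpose, hc.eq]
  have hsep : ∀ c : Matrix (Fin n) (Fin n) k, c.IsSymm → c.det ≠ 0 →
      (QuadraticMap.associated (Q c)).SeparatingLeft := by
    intro c hc hc0
    rw [hassoc c hc]
    exact LinearMap.separatingLeft_toLinearMap₂'_iff_det_ne_zero.2 hc0
  obtain ⟨e⟩ := QuadraticForm.equivalent_of_isAlgClosed (Q b) (Q 1) (hsep b hb hdet)
    (hsep 1 Matrix.isSymm_one (by simp))
  refine ⟨LinearMap.toMatrix' (e.toLinearEquiv : (Fin n → k) →ₗ[k] (Fin n → k)), ?_⟩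
  have hcomp : (Q 1).comp (e.toLinearEquiv : (Fin n → k) →ₗ[k] (Fin n → k)) = Q b := by
    ext v
    exact e.map_app v
  have hm : ∀ c : Matrix (Fin n) (Fin n) k, c.IsSymm → (Q c).toMatrix' = c := by
    intro c hc
    rw [QuadraticForm.toMatrix', hassoc c hc]
    simp
  have := QuadraticForm.toMatrix'_comp (Q 1) (e.toLinearEquiv : (Fin n → k) →ₗ[k] (Fin n → k))
  rw [hcomp, hm b hb, hm 1 Matrix.isSymm_one, mul_one] at this
  exact this.symm

variable {A : Type*} [CommRing A]

theorem isNilpotent_matrix_of_mem {I : Ideal A} (hI : IsNilpotent I)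
    {N : Matrix (Fin n) (Fin n) A} (hN : ∀ i j, N i j ∈ I) : IsNilpotent N := by
  obtain ⟨m, hm⟩ := hI
  have h : ∀ l i j, (N ^ l) i j ∈ I ^ l := by
    intro l
    induction l with
    | zero => simp
    | succ l ih =>
      intro i j
      rw [pow_succ, pow_succ, Matrix.mul_apply]
      exact Ideal.sum_mem _ fun x _ => Ideal.mul_mem_mul (ih i x) (hN x j)
  refine ⟨m, ?_⟩
  ext i j
  simpa [hm] using h m i j

/-- A symmetric matrix congruent to the identity modulo a nilpotent ideal is the square of a
symmetric matrix. -/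
theorem exists_symm_mul_self_eq_one_add {N : Matrix (Fin n) (Fin n) A} (hN : IsNilpotent N)
    (hsymm : N.IsSymm) (h2 : IsUnit (2 : A)) :
    ∃ D : Matrix (Fin n) (Fin n) A, D.IsSymm ∧ D * D = 1 + N := by
  -- The square root is sought in the commutative algebra `A[N]`, all of whose elements are
  -- symmetric as polynomials in `N`.
  let B := Algebra.adjoin A {N}
  let ν : B := ⟨N, Algebra.self_mem_adjoin_singleton A N⟩
  have : IsMulCommutative B := Algebra.isMulCommutative_adjoin A (by rintro _ rfl _ rfl; rfl)
  have hν : IsNilpotent ν := by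
    obtain ⟨m, hm⟩ := hN
    exact ⟨m, Subtype.ext hm⟩
  have hB : ∀ D ∈ B, Matrix.IsSymm D := by
    intro D hD
    induction hD using Algebra.adjoin_induction with
    | mem x hx => rw [Set.mem_singleton_iff.1 hx]; exact hsymm
    | algebraMap r => simp [Matrix.IsSymm, Matrix.algebraMap_eq_diagonal]
    | add x y _ _ hx hy => exact hx.add hy
    | mul x y hxm hym hx hy =>
      have hc : x * y = y * x := congrArg Subtype.val (mul_comm (⟨x, hxm⟩ : B) ⟨y, hym⟩)
      rw [Matrix.IsSymm, Matrix.transpose_mul, hx.eq, hy.eq, hc]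
  -- Newton's method for `X ^ 2 - (1 + N)` starting at `1`: the value there is nilpotent and the
  -- derivative `2` is a unit.
  let P : Polynomial B := Polynomial.X ^ 2 - Polynomial.C (1 + ν)
  have hP : Polynomial.aeval (1 : B) P = - ν := by simp [P]
  have hP' : IsUnit (Polynomial.aeval (1 : B) P.derivative) := by
    have : Polynomial.aeval (1 : B) P.derivative = algebraMap A B 2 := by
      simp [P, one_add_one_eq_two, map_ofNat]
    rw [this]
    exact h2.map _
  obtain ⟨r, ⟨-, hr⟩, -⟩ := Polynomial.existsUnique_nilpotent_sub_and_aeval_eq_zero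
    (x := (1 : B)) (P := P) (by rw [hP]; exact hν.neg) hP'
  refine ⟨r, hB _ r.2, ?_⟩
  have : r * r = 1 + ν := by
    rw [← sub_eq_zero]
    simpa [P, sq] using hr
  exact congrArg Subtype.val this

/-- A symmetric matrix that reduces to a nondegenerate one over an algebraically closed field
modulo a nilpotent ideal is of the form `Eᵀ * E`. -/
theorem exists_transpose_mul_self_eq_of_nilpotent [IsAlgClosed k] [Algebra k A] (h2 : (2 : k) ≠ 0)
    {I : Ideal A} (hI : IsNilpotent I) (B : Matrix (Fin n) (Fin n) A) (hB : B.IsSymm)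
    (b : Matrix (Fin n) (Fin n) k) (hb : b.IsSymm) (hdet : b.det ≠ 0)
    (hBb : ∀ i j, B i j - algebraMap k A (b i j) ∈ I) :
    ∃ E : Matrix (Fin n) (Fin n) A, IsUnit E ∧ Eᵀ * E = B := by
  obtain ⟨P, hP⟩ := exists_transpose_mul_self_eq h2 b hb hdet
  have hPdet : IsUnit P.det := by
    rw [isUnit_iff_ne_zero]
    rintro h
    rw [← hP, Matrix.det_mul, h, mul_zero] at hdet
    exact hdet rfl
  let φ := algebraMap k A
  let F : Matrix (Fin n) (Fin n) A := P.map φ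
  let G : Matrix (Fin n) (Fin n) A := P⁻¹.map φ
  have hGF : G * F = 1 := by
    rw [← Matrix.map_mul, Matrix.nonsing_inv_mul _ hPdet]
    simp
  have hFG : F * G = 1 := by
    rw [← Matrix.map_mul, Matrix.mul_nonsing_inv _ hPdet]
    simp
  have hFF : Fᵀ * F = b.map φ := by
    rw [← hP, Matrix.map_mul, Matrix.transpose_map]
  -- As `Gᵀ b G = 1`, this `N` is `Gᵀ B G - 1`. If `D` is a symmetric square root of `1 + N`, then
  -- `D F` is the required factor of `B`.
  let N := Gᵀ * (B - b.map φ) * G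
  have hN : ∀ i j, N i j ∈ I := by
    intro i j
    simp only [N, Matrix.mul_apply]
    refine Ideal.sum_mem _ fun x _ => Ideal.mul_mem_right _ _ (Ideal.sum_mem _ fun y _ =>
      Ideal.mul_mem_left _ _ ?_)
    simpa using hBb y x
  have hNs : N.IsSymm := by
    simp only [N, Matrix.IsSymm, Matrix.transpose_mul, Matrix.transpose_transpose,
      Matrix.transpose_sub, hB.eq, ← Matrix.transpose_map, hb.eq, Matrix.mul_assoc]
  have h2A : IsUnit (2 : A) := by
    have := (isUnit_iff_ne_zero.2 h2).map (algebraMap k A)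
    rwa [map_ofNat] at this
  have hNn := isNilpotent_matrix_of_mem hI hN
  obtain ⟨D, hDs, hD⟩ := exists_symm_mul_self_eq_one_add hNn hNs h2A
  refine ⟨D * F, IsUnit.mul ?_ ⟨(⟨F, G, hFG, hGF⟩ : (Matrix (Fin n) (Fin n) A)ˣ), rfl⟩, ?_⟩
  · refine isUnit_of_mul_isUnit_left (y := D) ?_
    rw [hD]
    exact hNn.isUnit_one_add
  · have hGt : Fᵀ * Gᵀ = 1 := by rw [← Matrix.transpose_mul, hGF, Matrix.transpose_one]
    calc (D * F)ᵀ * (D * F) = Fᵀ * (D * D) * F := by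
          rw [Matrix.transpose_mul, hDs.eq]; simp only [Matrix.mul_assoc]
      _ = Fᵀ * F + (Fᵀ * Gᵀ) * (B - b.map φ) * (G * F) := by
          rw [hD]; simp only [N, Matrix.mul_add, Matrix.add_mul, Matrix.mul_one, Matrix.mul_assoc]
      _ = B := by rw [hGt, hGF, hFF]; simp

theorem span_range_mulVec_le (E : Matrix (Fin n) (Fin n) A) (x : Fin n → A) :
    Ideal.span (Set.range (E *ᵥ x)) ≤ Ideal.span (Set.range x) := by
  rw [Ideal.span_le]
  rintro _ ⟨i, rfl⟩
  change ∑ j, E i j * x j ∈ Ideal.span (Set.range x)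
  exact Ideal.sum_mem _ fun j _ => Ideal.mul_mem_left _ _ (Ideal.subset_span ⟨j, rfl⟩)

theorem span_range_mulVec {E : Matrix (Fin n) (Fin n) A} (hE : IsUnit E) (x : Fin n → A) :
    Ideal.span (Set.range (E *ᵥ x)) = Ideal.span (Set.range x) := by
  refine le_antisymm (span_range_mulVec_le E x) ?_
  obtain ⟨F, hF⟩ := hE.exists_left_inv
  have h := span_range_mulVec_le F (E *ᵥ x)
  rwa [Matrix.mulVec_mulVec, hF, Matrix.one_mulVec] at h

theorem sum_sq_mulVec (E : Matrix (Fin n) (Fin n) A) (x : Fin n → A) :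
    ∑ i, (E *ᵥ x) i ^ 2 = ∑ i, ∑ j, (Eᵀ * E) i j * x i * x j := by
  have h1 : ∑ i, (E *ᵥ x) i ^ 2 = (E *ᵥ x) ⬝ᵥ (E *ᵥ x) := by simp [dotProduct, sq]
  have h2 : ∑ i, ∑ j, (Eᵀ * E) i j * x i * x j = x ⬝ᵥ ((Eᵀ * E) *ᵥ x) := by
    simp only [dotProduct, Matrix.mulVec, Finset.mul_sum]
    exact Finset.sum_congr rfl fun i _ => Finset.sum_congr rfl fun j _ => by ring
  rw [h1, h2, ← Matrix.mulVec_mulVec, Matrix.dotProduct_mulVec x,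
    Matrix.vecMul_transpose]

end Morse

/-! ### Coordinate changes in the truncated ring and comparison with the sum of squares. -/

section TruncRing

variable {k : Type*} [Field k] {n : ℕ}

open MvPowerSeries

theorem mul_mem_ideal_pow_succ {A : Type*} [CommRing A] {I : Ideal A} {N : ℕ} {x y : A}
    (hx : x ∈ I ^ N) (hy : y ∈ I) : x * y ∈ I ^ (N + 1) := by
  rw [pow_succ]
  exact Ideal.mul_mem_mul hx hy

theorem mulLeft_add_smul {A : Type*} [CommRing A] [Algebra k A] (a b : A) (s : k) :
    LinearMap.mulLeft k (a + s • b) = LinearMap.mulLeft k a + s • LinearMap.mulLeft k b := by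
  ext x
  simp [add_mul]

/-- The class of a variable in the truncated ring. -/
noncomputable def truncVar (k : Type*) [Field k] {n : ℕ} (q : ℕ) (i : Fin n) : TruncRing k n q :=
  Ideal.Quotient.mk _ (X i)

theorem truncVar_pow (q : ℕ) (i : Fin n) : truncVar k q i ^ q = 0 := by
  rw [truncVar, ← map_pow, Ideal.Quotient.eq_zero_iff_mem]
  exact Ideal.subset_span ⟨i, rfl⟩

theorem isNilpotent_span_truncVar (q : ℕ) :
    IsNilpotent (Ideal.span (Set.range (truncVar (n := n) k q))) := by
  rw [Ideal.FG.isNilpotent_iff_le_nilradical (IsNoetherian.noetherian _), Ideal.span_le]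
  rintro _ ⟨i, rfl⟩
  exact ⟨q, truncVar_pow q i⟩

theorem exists_sub_algebraMap_mem_span_truncVar (q : ℕ) (a : TruncRing k n q) :
    ∃ c : k, a - algebraMap k _ c ∈ Ideal.span (Set.range (truncVar (n := n) k q)) := by
  obtain ⟨g, rfl⟩ := Ideal.Quotient.mk_surjective a
  refine ⟨constantCoeff g, ?_⟩
  have h : g - C (constantCoeff g) ∈ Ideal.span (Set.range (X (R := k) (σ := Fin n))) := by
    rw [← maximalIdeal_eq_span_X, mem_maximalIdeal_iff_constantCoeff]
    simp
  have h2 := Ideal.mem_map_of_mem (Ideal.Quotient.mk (varPowIdeal k n q)) h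
  rw [Ideal.map_span, ← Set.range_comp] at h2
  exact h2

/-- Generators of the maximal ideal generate the truncated ring as an algebra. -/
theorem aeval_surjective_of_span_eq (q : ℕ) (y : Fin n → TruncRing k n q)
    (hy : Ideal.span (Set.range y) = Ideal.span (Set.range (truncVar k q))) :
    Function.Surjective (MvPolynomial.aeval (R := k) y) := by
  -- Successive approximation modulo powers of the maximal ideal, exact once the power vanishes.
  have h : ∀ N : ℕ, ∀ a : TruncRing k n q, ∃ P : MvPolynomial (Fin n) k,
      a - MvPolynomial.aeval y P ∈ Ideal.span (Set.range y) ^ N := by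
    intro N
    induction N with
    | zero => simp
    | succ N ih =>
      intro a
      obtain ⟨c, hc⟩ := exists_sub_algebraMap_mem_span_truncVar q a
      rw [← hy] at hc
      obtain ⟨b, hb⟩ := Ideal.mem_span_range_iff_exists_fun.1 hc
      choose P hP using fun i => ih (b i)
      refine ⟨MvPolynomial.C c + ∑ i, P i * MvPolynomial.X i, ?_⟩
      have : a - MvPolynomial.aeval y (MvPolynomial.C c + ∑ i, P i * MvPolynomial.X i) =
          ∑ i, (b i - MvPolynomial.aeval y (P i)) * y i := by
        simp only [map_add, map_sum, map_mul, MvPolynomial.aeval_X, sub_mul, Finset.sum_sub_distrib,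
          hb, MvPolynomial.aeval_C]
        ring
      rw [this]
      exact Ideal.sum_mem _ fun i _ => mul_mem_ideal_pow_succ (hP i) (Ideal.subset_span ⟨i, rfl⟩)
  obtain ⟨N, hN⟩ := isNilpotent_span_truncVar (k := k) (n := n) q
  intro a
  obtain ⟨P, hP⟩ := h N a
  rw [hy, hN, Ideal.zero_eq_bot, Ideal.mem_bot, sub_eq_zero] at hP
  exact ⟨P, hP.symm⟩

theorem aeval_truncVar (q : ℕ) (P : MvPolynomial (Fin n) k) :
    MvPolynomial.aeval (truncVar k q) P =
      Ideal.Quotient.mk (varPowIdeal k n q) (P : MvPowerSeries (Fin n) k) := by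
  induction P using MvPolynomial.induction_on with
  | C a => rw [MvPolynomial.aeval_C, MvPolynomial.coe_C]; rfl
  | add P Q hP hQ => simp [hP, hQ]
  | mul_X P i hP => simp [hP, truncVar]

/-- A polynomial vanishing in the truncated ring has only monomials with some exponent at least `q`,
and these also vanish at `y`. Hence `x_i ↦ y_i` is well defined. -/
theorem aeval_eq_zero_of_aeval_truncVar_eq_zero (q : ℕ) {y : Fin n → TruncRing k n q}
    (hy : ∀ i, y i ^ q = 0) {P : MvPolynomial (Fin n) k}
    (hP : MvPolynomial.aeval (truncVar k q) P = 0) : MvPolynomial.aeval y P = 0 := by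
  rw [aeval_truncVar, Ideal.Quotient.eq_zero_iff_mem, mem_varPowIdeal_iff] at hP
  rw [MvPolynomial.aeval_def, MvPolynomial.eval₂_eq']
  refine Finset.sum_eq_zero fun m hm => ?_
  by_cases h : ∀ i, m i < q
  · have := hP m h
    rw [MvPolynomial.coeff_coe] at this
    rw [this, map_zero, zero_mul]
  · push Not at h
    obtain ⟨i, hi⟩ := h
    have h0 : ∏ j, y j ^ m j = 0 :=
      Finset.prod_eq_zero (Finset.mem_univ i) (pow_eq_zero_of_le hi (hy i))
    rw [h0, mul_zero]

/-- A system of generators of the maximal ideal of the truncated ring whose `q`-th powers vanish is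
the image of the variables under an automorphism. -/
theorem exists_algEquiv_truncVar (q : ℕ) (y : Fin n → TruncRing k n q) (hyq : ∀ i, y i ^ q = 0)
    (hy : Ideal.span (Set.range y) = Ideal.span (Set.range (truncVar k q))) :
    ∃ e : TruncRing k n q ≃ₐ[k] TruncRing k n q, ∀ i, e (truncVar k q i) = y i := by
  let φ := MvPolynomial.aeval (R := k) (truncVar (n := n) k q)
  have hφ : Function.Surjective φ := aeval_surjective_of_span_eq q _ rfl
  let ψ := MvPolynomial.aeval (R := k) y
  have hker : ∀ P ∈ RingHom.ker φ, ψ P = 0 := fun P hP =>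
    aeval_eq_zero_of_aeval_truncVar_eq_zero q hyq hP
  let Θ : TruncRing k n q →ₐ[k] TruncRing k n q :=
    (Ideal.Quotient.liftₐ (RingHom.ker φ) ψ hker).comp
      (Ideal.quotientKerAlgEquivOfSurjective hφ).symm.toAlgHom
  have hΘ : ∀ P, Θ (φ P) = ψ P := by
    intro P
    have : (Ideal.quotientKerAlgEquivOfSurjective hφ).symm (φ P) = Ideal.Quotient.mk _ P := by
      rw [AlgEquiv.symm_apply_eq]; rfl
    change Ideal.Quotient.liftₐ (RingHom.ker φ) ψ hker
      ((Ideal.quotientKerAlgEquivOfSurjective hφ).symm (φ P)) = _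
    rw [this]
    rfl
  have hs : Function.Surjective Θ := fun a => by
    obtain ⟨P, rfl⟩ := aeval_surjective_of_span_eq q y hy a
    exact ⟨φ P, hΘ P⟩
  -- A surjective endomorphism of a finite-dimensional space is injective.
  have hi : Function.Injective Θ :=
    (LinearMap.injective_iff_surjective (f := Θ.toLinearMap)).2 hs
  refine ⟨AlgEquiv.ofBijective Θ ⟨hi, hs⟩, fun i => ?_⟩
  have := hΘ (MvPolynomial.X i)
  simp only [φ, ψ, MvPolynomial.aeval_X] at this
  exact this

/-- The dimension of `k[[X_0, …]] / (f, X_i ^ q)`. -/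
noncomputable def truncColength (q : ℕ) (f : MvPowerSeries (Fin n) k) : ℕ :=
  colength k (Ideal.Quotient.mk (varPowIdeal k n q) f)

/-- The `p ^ e`-th power map is additive, so it suffices that it kills the variables. This makes
every linear change of coordinates over the truncated ring admissible. -/
theorem pow_eq_zero_of_mem_span_truncVar (p : ℕ) [Fact p.Prime] [CharP k p] (e : ℕ)
    {a : TruncRing k n (p ^ e)} (ha : a ∈ Ideal.span (Set.range (truncVar k (p ^ e)))) :
    a ^ (p ^ e) = 0 := by
  rcases subsingleton_or_nontrivial (TruncRing k n (p ^ e)) with _ | _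
  · exact Subsingleton.elim _ _
  have : CharP (TruncRing k n (p ^ e)) p :=
    charP_of_injective_algebraMap (algebraMap k (TruncRing k n (p ^ e))).injective p
  obtain ⟨b, rfl⟩ := Ideal.mem_span_range_iff_exists_fun.1 ha
  rw [sum_pow_char_pow]
  exact Finset.sum_eq_zero fun i _ => by rw [mul_pow, truncVar_pow, mul_zero]

/-- A quadratic expression with nondegenerate quadratic part has the colengths of the sum of
squares. -/
theorem truncColength_sum_sq_eq [IsAlgClosed k] (h2 : (2 : k) ≠ 0) (p : ℕ) [Fact p.Prime]
    [CharP k p] (e : ℕ) (b : Matrix (Fin n) (Fin n) (MvPowerSeries (Fin n) k)) (hb : b.IsSymm)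
    (hdet : (b.map constantCoeff).det ≠ 0) :
    truncColength (p ^ e) (∑ i, ∑ j, b i j * X i * X j) =
      truncColength (p ^ e) (∑ i : Fin n, (X i : MvPowerSeries (Fin n) k) ^ 2) := by
  obtain ⟨E, hE, hEB⟩ := exists_transpose_mul_self_eq_of_nilpotent h2
    (isNilpotent_span_truncVar (k := k) (n := n) (p ^ e))
    (b.map (Ideal.Quotient.mk (varPowIdeal k n (p ^ e))))
    (by rw [Matrix.IsSymm, ← Matrix.transpose_map, hb.eq]) (b.map constantCoeff)
    (by rw [Matrix.IsSymm, ← Matrix.transpose_map, hb.eq]) hdet (by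
      intro i j
      have h : b i j - C (constantCoeff (b i j)) ∈ Ideal.span (Set.range (X (R := k) (σ := Fin n))) := by
        rw [← maximalIdeal_eq_span_X, mem_maximalIdeal_iff_constantCoeff]
        simp
      have h2 := Ideal.mem_map_of_mem (Ideal.Quotient.mk (varPowIdeal k n (p ^ e))) h
      rw [Ideal.map_span, ← Set.range_comp] at h2
      exact h2)
  have hspan := span_range_mulVec hE (truncVar k (p ^ e))
  obtain ⟨Θ, hΘ⟩ := exists_algEquiv_truncVar (p ^ e) (E.mulVec (truncVar k (p ^ e)))
    (fun i => pow_eq_zero_of_mem_span_truncVar p e (hspan ▸ Ideal.subset_span ⟨i, rfl⟩)) hspan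
  rw [truncColength, truncColength,
    ← colength_algEquiv Θ (Ideal.Quotient.mk (varPowIdeal k n (p ^ e)) (∑ i : Fin n, X i ^ 2))]
  congr 1
  simp only [map_sum, map_pow, map_mul]
  have h1 := sum_sq_mulVec E (truncVar k (p ^ e))
  rw [hEB] at h1
  refine h1.symm.trans (Finset.sum_congr rfl fun i _ => ?_)
  rw [← hΘ]
  rfl

/-- The exceptional `s` are the negatives of the eigenvalues of `M`. -/
theorem finite_setOf_det_add_smul_one_eq_zero (M : Matrix (Fin n) (Fin n) k) :
    {s : k | (M + s • (1 : Matrix (Fin n) (Fin n) k)).det = 0}.Finite := by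
  refine ((Matrix.finite_spectrum M).image fun s => -s).subset fun s hs => ?_
  refine ⟨-s, ?_, neg_neg s⟩
  rw [spectrum.mem_iff, Matrix.isUnit_iff_isUnit_det, isUnit_iff_ne_zero, not_not]
  have h : algebraMap k (Matrix (Fin n) (Fin n) k) (-s) - M =
      - (M + s • (1 : Matrix (Fin n) (Fin n) k)) := by
    rw [Algebra.algebraMap_eq_smul_one, neg_smul]; abel
  rw [h, Matrix.det_neg, show (M + s • (1 : Matrix (Fin n) (Fin n) k)).det = 0 from hs, mul_zero]

/-- The sum of squares has the smallest colengths among the quadratic expressions. -/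
theorem truncColength_sum_sq_le [IsAlgClosed k] (h2 : (2 : k) ≠ 0) (p : ℕ) [Fact p.Prime]
    [CharP k p] (e : ℕ) (a : Matrix (Fin n) (Fin n) (MvPowerSeries (Fin n) k)) :
    truncColength (p ^ e) (∑ i : Fin n, (X i : MvPowerSeries (Fin n) k) ^ 2) ≤
      truncColength (p ^ e) (∑ i, ∑ j, a i j * X i * X j) := by
  have hinf : Infinite k := IsAlgClosed.instInfinite
  let a' : Matrix (Fin n) (Fin n) (MvPowerSeries (Fin n) k) := (2⁻¹ : k) • (a + a.transpose)
  have ha' : a'.IsSymm := by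
    simp only [a', Matrix.IsSymm, Matrix.transpose_smul, Matrix.transpose_add,
      Matrix.transpose_transpose, add_comm]
  set f := ∑ i, ∑ j, a i j * X i * X j with hf
  let g : MvPowerSeries (Fin n) k := ∑ i : Fin n, (X i : MvPowerSeries (Fin n) k) ^ 2
  have hfa : f = ∑ i, ∑ j, a' i j * X i * X j := by
    have hT : f = ∑ i, ∑ j, a.transpose i j * X i * X j := by
      rw [hf, Finset.sum_comm]
      exact Finset.sum_congr rfl fun i _ => Finset.sum_congr rfl fun j _ => by
        rw [Matrix.transpose_apply]; ring
    have : (2 : k) • f = ∑ i, ∑ j, (a + a.transpose) i j * X i * X j := by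
      rw [two_smul]
      nth_rw 2 [hT]
      rw [hf]
      simp only [Matrix.add_apply, add_mul, Finset.sum_add_distrib]
    rw [← inv_smul_smul₀ h2 f, this, Finset.smul_sum]
    refine Finset.sum_congr rfl fun i _ => ?_
    rw [Finset.smul_sum]
    refine Finset.sum_congr rfl fun j _ => ?_
    simp only [a', Matrix.smul_apply, smul_mul_assoc]
  let π := Ideal.Quotient.mk (varPowIdeal k n (p ^ e))
  -- As `k` is infinite, some `s` avoids both finite sets: degenerate quadratic part, and drop in
  -- the rank of multiplication.
  obtain ⟨s, hs⟩ := ((finite_setOf_det_add_smul_one_eq_zero (a'.map constantCoeff)).union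
    (finite_setOf_finrank_range_add_smul_lt (LinearMap.mulLeft k (π f))
      (LinearMap.mulLeft k (π g)))).exists_notMem
  rw [Set.mem_union, not_or] at hs
  obtain ⟨hs1, hs2⟩ := hs
  let b := a' + s • (1 : Matrix (Fin n) (Fin n) (MvPowerSeries (Fin n) k))
  have hb : b.IsSymm := ha'.add (Matrix.isSymm_one.smul s)
  have hbdet : (b.map constantCoeff).det ≠ 0 := by
    have : b.map constantCoeff = a'.map constantCoeff + s • (1 : Matrix (Fin n) (Fin n) k) := by
      ext i j
      by_cases hij : i = j <;> simp [b, hij, smul_eq_C_mul]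
    rw [this]
    exact hs1
  have hbs : ∑ i, ∑ j, b i j * X i * X j = f + s • g := by
    rw [hfa, Finset.smul_sum, ← Finset.sum_add_distrib]
    refine Finset.sum_congr rfl fun i _ => ?_
    simp only [b, Matrix.add_apply, add_mul, Finset.sum_add_distrib, Matrix.smul_apply,
      Matrix.one_apply]
    simp [sq]
  rw [← truncColength_sum_sq_eq h2 p e b hb hbdet, hbs, truncColength, truncColength]
  have h1 := colength_add_finrank_range (k := k) (π f)
  have h3 := colength_add_finrank_range (k := k) (π (f + s • g))
  have h4 : LinearMap.mulLeft k (π (f + s • g)) =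
      LinearMap.mulLeft k (π f) + s • LinearMap.mulLeft k (π g) := by
    rw [← mulLeft_add_smul]
    rfl
  rw [h4] at h3
  rw [Set.mem_ofPred_eq] at hs2
  change colength k (π (f + s • g)) ≤ colength k (π f)
  omega

end TruncRing

/-! ### Monotonicity under Frobenius. -/

section Growth

variable {k : Type*} [Field k] {n : ℕ}

open MvPowerSeries

instance charP_mvPowerSeries_fin (p : ℕ) [CharP k p] : CharP (MvPowerSeries (Fin n) k) p :=
  charP_of_injective_algebraMap (algebraMap k (MvPowerSeries (Fin n) k)).injective p

/-- The Frobenius map from the truncation at `q` to the truncation at `q * p`. -/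
noncomputable def truncFrobenius (k : Type*) [Field k] (n p : ℕ) [Fact p.Prime] [CharP k p]
    (q : ℕ) : TruncRing k n q →+* TruncRing k n (q * p) :=
  Ideal.quotientMap _ (frobenius (MvPowerSeries (Fin n) k) p) (by
    rw [varPowIdeal, Ideal.span_le]
    rintro _ ⟨i, rfl⟩
    rw [SetLike.mem_coe, Ideal.mem_comap, frobenius_def, ← pow_mul]
    exact Ideal.subset_span ⟨i, rfl⟩)

variable (p : ℕ) [Fact p.Prime] [CharP k p]

theorem truncFrobenius_mk (q : ℕ) (f : MvPowerSeries (Fin n) k) :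
    truncFrobenius k n p q (Ideal.Quotient.mk _ f) = Ideal.Quotient.mk _ (f ^ p) := by
  rw [truncFrobenius, Ideal.quotientMap_mk, frobenius_def]

theorem truncFrobenius_smul (q : ℕ) (c : k) (a : TruncRing k n q) :
    truncFrobenius k n p q (c • a) = c ^ p • truncFrobenius k n p q a := by
  obtain ⟨f, rfl⟩ := Ideal.Quotient.mk_surjective a
  change truncFrobenius k n p q (Ideal.Quotient.mk _ (c • f)) = _
  rw [truncFrobenius_mk, truncFrobenius_mk, smul_pow]
  rfl

/-- Write `x ^ m = x ^ r φ(x ^ t)` with `m = r + p t`, all `r_i < p`, and `φ` the Frobenius map.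
Then `f ^ p x ^ m = x ^ r φ(f x ^ t)`. Since `φ` is semilinear, the range is spanned by the products
of the `p ^ n` monomials `x ^ r` with the images of a basis of the range of `f`. -/
theorem finrank_range_mulLeft_pow_le (q : ℕ) (f : MvPowerSeries (Fin n) k) :
    Module.finrank k (LinearMap.range (LinearMap.mulLeft k
      (Ideal.Quotient.mk (varPowIdeal k n (q * p)) (f ^ p)))) ≤
      p ^ n * Module.finrank k (LinearMap.range (LinearMap.mulLeft k
        (Ideal.Quotient.mk (varPowIdeal k n q) f))) := by
  set L := LinearMap.mulLeft k (Ideal.Quotient.mk (varPowIdeal k n q) f) with hL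
  let w := Module.finBasis k (LinearMap.range L)
  let φ := truncFrobenius k n p q
  let v : (Fin n → Fin p) × Fin (Module.finrank k (LinearMap.range L)) → TruncRing k n (q * p) :=
    fun aj => (∏ i, truncVar k (q * p) i ^ (aj.1 i : ℕ)) * φ (w aj.2)
  have hp : 0 < p := (Fact.out : p.Prime).pos
  have key : LinearMap.range (LinearMap.mulLeft k
      (Ideal.Quotient.mk (varPowIdeal k n (q * p)) (f ^ p))) ≤ Submodule.span k (Set.range v) := by
    rintro _ ⟨a, rfl⟩
    obtain ⟨P, rfl⟩ := aeval_surjective_of_span_eq (q * p) (truncVar k (q * p)) rfl a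
    rw [LinearMap.mulLeft_apply]
    induction P using MvPolynomial.induction_on' with
    | add P Q hP hQ =>
      rw [map_add, mul_add]
      exact add_mem hP hQ
    | monomial m c =>
      rw [MvPolynomial.aeval_monomial, Algebra.algebraMap_eq_smul_one, smul_mul_assoc, one_mul,
        mul_smul_comm]
      refine Submodule.smul_mem _ _ ?_
      let b : TruncRing k n q := ∏ i, truncVar k q i ^ (m i / p)
      have hb : φ b = ∏ i, truncVar k (q * p) i ^ (p * (m i / p)) := by
        simp only [b, map_prod, map_pow]
        refine Finset.prod_congr rfl fun i _ => ?_
        rw [pow_mul, truncVar, truncFrobenius_mk, ← map_pow, map_pow]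
        rfl
      have hm : (m.prod fun i e => truncVar k (q * p) i ^ e) =
          (∏ i, truncVar k (q * p) i ^ (m i % p)) * φ b := by
        rw [hb, ← Finset.prod_mul_distrib, Finsupp.prod_fintype _ _ fun i => pow_zero _]
        refine Finset.prod_congr rfl fun i _ => ?_
        rw [← pow_add, Nat.mod_add_div]
      have hLb : L b ∈ LinearMap.range L := ⟨b, rfl⟩
      have hsum : L b = ∑ j, w.repr ⟨L b, hLb⟩ j • (w j : TruncRing k n q) := by
        have := congrArg Subtype.val (w.sum_repr ⟨L b, hLb⟩)
        exact this.symm.trans (AddSubmonoidClass.coe_finsetSum _ _)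
      have hφ : φ (L b) = ∑ j, (w.repr ⟨L b, hLb⟩ j) ^ p • φ (w j) := by
        conv_lhs => rw [hsum]
        rw [map_sum]
        exact Finset.sum_congr rfl fun j _ => truncFrobenius_smul p q _ _
      have hfin : Ideal.Quotient.mk (varPowIdeal k n (q * p)) (f ^ p) *
          (m.prod fun i e => truncVar k (q * p) i ^ e) =
          ∑ j, (w.repr ⟨L b, hLb⟩ j) ^ p • v (fun i => ⟨m i % p, Nat.mod_lt _ hp⟩, j) := by
        calc _ = (∏ i, truncVar k (q * p) i ^ (m i % p)) * φ (L b) := by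
              rw [hm, hL, LinearMap.mulLeft_apply, map_mul]
              rw [show φ (Ideal.Quotient.mk (varPowIdeal k n q) f) = _ from truncFrobenius_mk p q f]
              ring
          _ = _ := by
              rw [hφ, Finset.mul_sum]
              exact Finset.sum_congr rfl fun j _ => mul_smul_comm _ _ _
      rw [hfin]
      exact sum_mem fun j _ => Submodule.smul_mem _ _ (Submodule.subset_span ⟨_, rfl⟩)
  refine (Submodule.finrank_mono key).trans ((finrank_range_le_card v).trans ?_)
  simp

/-- The normalized colengths are nondecreasing. -/
theorem pow_mul_truncColength_le (d q : ℕ) (f : MvPowerSeries (Fin (d + 1)) k) :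
    p ^ d * truncColength q f ≤ truncColength (q * p) f := by
  have hp : 0 < p := (Fact.out : p.Prime).pos
  have h1 := finrank_range_mulLeft_pow_le p q f
  have h2 := colength_add_finrank_range (k := k) (Ideal.Quotient.mk (varPowIdeal k (d + 1) q) f)
  have h3 := colength_add_finrank_range (k := k)
    (Ideal.Quotient.mk (varPowIdeal k (d + 1) (q * p)) (f ^ p))
  have h4 := colength_pow_le (k := k) (Ideal.Quotient.mk (varPowIdeal k (d + 1) (q * p)) f) p
  rw [← map_pow] at h4
  rw [finrank_truncRing] at h2 h3
  -- Put `n = d + 1`. Passing to complements, the rank bound says that `p ^ n` times the colength of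
  -- `f` at `q` is at most the colength of `f ^ p` at `q * p`. The latter is at most `p` times the
  -- colength of `f` there, and one factor `p` cancels.
  refine le_of_mul_le_mul_left ?_ hp
  refine le_trans ?_ h4
  rw [← mul_assoc, ← pow_succ']
  have h5 : p ^ (d + 1) * (colength k (Ideal.Quotient.mk (varPowIdeal k (d + 1) q) f) +
      Module.finrank k (LinearMap.range (LinearMap.mulLeft k
        (Ideal.Quotient.mk (varPowIdeal k (d + 1) q) f)))) = (q * p) ^ (d + 1) := by
    rw [h2, mul_pow, mul_comm]
  rw [mul_add] at h5
  rw [truncColength]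
  omega

end Growth

/-! ### Boundedness of the normalized colengths. -/

section Bound

variable {k : Type*} [Field k] {n : ℕ}

open MvPowerSeries

/-- This is `∏ (1 - a_i / q) ≥ 1 - ∑ a_i / q` cleared of denominators. The extra factor `q` avoids
the exponent `s.card - 1`; truncated subtraction is harmless because `q ≤ (q - a_i) + a_i`. -/
theorem mul_pow_le_mul_prod_sub_add {ι : Type*} (s : Finset ι) (a : ι → ℕ) (q : ℕ) :
    q * q ^ s.card ≤ q * ∏ i ∈ s, (q - a i) + (∑ i ∈ s, a i) * q ^ s.card := by
  classical
  induction s using Finset.induction_on with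
  | empty => simp
  | insert i s hi ih =>
    rw [Finset.prod_insert hi, Finset.sum_insert hi, Finset.card_insert_of_notMem hi, pow_succ]
    have hP : ∏ j ∈ s, (q - a j) ≤ q ^ s.card :=
      Finset.prod_le_pow_card _ _ _ fun j _ => Nat.sub_le _ _
    set P := ∏ j ∈ s, (q - a j)
    set Q := q ^ s.card
    set A := ∑ j ∈ s, a j
    have h1 : q ≤ (q - a i) + a i := by omega
    calc q * (Q * q) = (q * Q) * q := by ring
      _ ≤ (q * P + A * Q) * q := by gcongr
      _ = q * P * q + A * Q * q := by ring
      _ ≤ q * P * ((q - a i) + a i) + A * Q * q := by gcongr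
      _ = q * ((q - a i) * P) + a i * P * q + A * Q * q := by ring
      _ ≤ q * ((q - a i) * P) + a i * Q * q + A * Q * q := by gcongr
      _ = _ := by ring

/-- The multiples of `f` by the polynomials of small degree stay independent in the truncated
ring. -/
theorem prod_sub_le_finrank_range_mulLeft {f : MvPowerSeries (Fin n) k} {a : Fin n →₀ ℕ}
    (ha : lexOrder f = toLex a) (q : ℕ) :
    ∏ i, (q - a i) ≤ Module.finrank k (LinearMap.range (LinearMap.mulLeft k
      (Ideal.Quotient.mk (varPowIdeal k n q) f))) := by
  classical
  let H : ((i : Fin n) → Fin (q - a i)) → MvPowerSeries (Fin n) k := fun b =>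
    monomial (Finsupp.equivFunOnFinite.symm fun i => (b i : ℕ)) 1
  let T : (((i : Fin n) → Fin (q - a i)) → k) →ₗ[k] MvPowerSeries (Fin n) k :=
    Fintype.linearCombination k H
  let π : MvPowerSeries (Fin n) k →ₗ[k] TruncRing k n q :=
    (Ideal.Quotient.mkₐ k (varPowIdeal k n q)).toLinearMap
  let U : (((i : Fin n) → Fin (q - a i)) → k) →ₗ[k] LinearMap.range (LinearMap.mulLeft k
      (Ideal.Quotient.mk (varPowIdeal k n q) f)) :=
    (LinearMap.mulLeft k (Ideal.Quotient.mk (varPowIdeal k n q) f)).rangeRestrict ∘ₗ π ∘ₗ T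
  have hTcoeff : ∀ c m, coeff m (T c) ≠ 0 → ∃ b : (i : Fin n) → Fin (q - a i),
      c b ≠ 0 ∧ ∀ i, m i = b i := by
    intro c m hm
    by_contra hcon
    push Not at hcon
    refine hm ?_
    rw [Fintype.linearCombination_apply, map_sum]
    refine Finset.sum_eq_zero fun b _ => ?_
    rw [map_smul, coeff_monomial]
    split_ifs with hmb
    · by_cases hcb : c b = 0
      · simp [hcb]
      · obtain ⟨i, hi⟩ := hcon b hcb
        exact absurd (by rw [hmb]; rfl) hi
    · simp
  have hTinj : Function.Injective T := by
    rw [injective_iff_map_eq_zero]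
    intro c hc
    funext b
    have h := congrArg (coeff (Finsupp.equivFunOnFinite.symm fun i => (b i : ℕ))) hc
    rw [Fintype.linearCombination_apply, map_sum, Finset.sum_eq_single b] at h
    · simpa [H] using h
    · intro b' _ hb'
      rw [map_smul, coeff_monomial, if_neg, smul_zero]
      intro heq
      refine hb' (funext fun i => Fin.ext ?_)
      exact (congrFun (Finsupp.equivFunOnFinite.symm.injective heq) i).symm
    · simp
  have hU : Function.Injective U := by
    rw [injective_iff_map_eq_zero]
    intro c hc
    by_contra hc0
    have hT0 : T c ≠ 0 := fun h => hc0 (hTinj (h.trans (map_zero T).symm))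
    obtain ⟨m, hm⟩ := exists_finsupp_eq_lexOrder_of_ne_zero hT0
    have hmc := coeff_ne_zero_of_lexOrder hm.symm
    -- The lex-initial exponent `m` of the combination satisfies `m_i < q - a_i`, so the initial
    -- exponent `a + m` of the product stays below `q` in each variable and survives truncation.
    obtain ⟨b, -, hb⟩ := hTcoeff c m hmc
    have hne : coeff (a + m) (f * T c) ≠ 0 := by
      rw [coeff_mul_of_add_lexOrder ha hm]
      exact mul_ne_zero (coeff_ne_zero_of_lexOrder ha.symm) hmc
    refine hne ?_
    have hmem : f * T c ∈ varPowIdeal k n q := by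
      rw [← Ideal.Quotient.eq_zero_iff_mem, map_mul]
      exact congrArg Subtype.val hc
    refine mem_varPowIdeal_iff.1 hmem _ fun i => ?_
    have := (b i).2
    rw [Finsupp.add_apply, hb]
    omega
  have := LinearMap.finrank_le_finrank_of_injective hU
  simpa using this

/-- The colength is `q ^ (d + 1)` minus the rank, and the rank is at least `∏ (q - a_i)` for `a` the
lex-initial exponent of `f`; so `∑ a_i` serves as the constant. -/
theorem exists_truncColength_le {d : ℕ} {f : MvPowerSeries (Fin (d + 1)) k} (hf : f ≠ 0) :
    ∃ c : ℕ, ∀ q : ℕ, 0 < q → truncColength q f ≤ c * q ^ d := by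
  obtain ⟨a, ha⟩ := exists_finsupp_eq_lexOrder_of_ne_zero hf
  refine ⟨∑ i, a i, fun q hq => ?_⟩
  have h1 := prod_sub_le_finrank_range_mulLeft ha q
  have h2 := colength_add_finrank_range (k := k) (Ideal.Quotient.mk (varPowIdeal k (d + 1) q) f)
  have h3 := mul_pow_le_mul_prod_sub_add Finset.univ (fun i => a i) q
  rw [finrank_truncRing] at h2
  rw [Finset.card_univ, Fintype.card_fin, pow_succ, mul_comm _ q, mul_left_comm (∑ i, a i) q,
    ← mul_add] at h3
  have h4 := Nat.le_of_mul_le_mul_left h3 hq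
  rw [pow_succ, mul_comm _ q] at h2
  rw [truncColength]
  omega

end Bound

/-! ### Existence of the limits and the final comparison. -/

section HilbertKunz

variable {k : Type*} [Field k] {d : ℕ} (p : ℕ) [Fact p.Prime] [CharP k p]

theorem hilbertKunzSeq_hypersurface {f : MvPowerSeries (Fin (d + 1)) k} (hf : f ≠ 0)
    [IsLocalRing (HypersurfaceRing f)] (e : ℕ) :
    hilbertKunzSeq p (IsLocalRing.maximalIdeal (HypersurfaceRing f)) e =
      (truncColength (p ^ e) f : ℝ) / ((p : ℝ) ^ e) ^ d := by
  rw [hilbertKunzSeq, krullDimNat_hypersurface hf hypersurface_mem_maximalIdeal,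
    length_quotient_bracketPower, ENat.toNat_natCast]
  rfl

theorem hilbertKunzLimitExists_hypersurface {f : MvPowerSeries (Fin (d + 1)) k} (hf : f ≠ 0)
    [IsLocalRing (HypersurfaceRing f)] : HilbertKunzLimitExists p (HypersurfaceRing f) := by
  have hp : (0 : ℝ) < p := by exact_mod_cast (Fact.out : p.Prime).pos
  apply tendsto_nhds_limUnder
  obtain ⟨c, hc⟩ := exists_truncColength_le hf
  have hmono : Monotone (hilbertKunzSeq p (IsLocalRing.maximalIdeal (HypersurfaceRing f))) := by
    refine monotone_nat_of_le_succ fun e => ?_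
    rw [hilbertKunzSeq_hypersurface p hf, hilbertKunzSeq_hypersurface p hf,
      div_le_div_iff₀ (by positivity) (by positivity)]
    have h := pow_mul_truncColength_le p d (p ^ e) f
    rw [← pow_succ] at h
    have h' : (p : ℝ) ^ d * truncColength (p ^ e) f ≤ truncColength (p ^ (e + 1)) f := by
      exact_mod_cast h
    calc (truncColength (p ^ e) f : ℝ) * ((p : ℝ) ^ (e + 1)) ^ d
        = ((p : ℝ) ^ d * truncColength (p ^ e) f) * ((p : ℝ) ^ e) ^ d := by
          rw [pow_succ, mul_pow]; ring
      _ ≤ _ := by gcongr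
  refine ⟨_, tendsto_atTop_ciSup hmono ⟨c, ?_⟩⟩
  rintro _ ⟨e, rfl⟩
  rw [hilbertKunzSeq_hypersurface p hf, div_le_iff₀ (by positivity)]
  exact_mod_cast hc (p ^ e) (pow_pos (Fact.out : p.Prime).pos e)

theorem sumOfSquares_ne_zero : sumOfSquares k d ≠ 0 := by
  classical
  intro h
  have h1 := congrArg (MvPowerSeries.coeff (Finsupp.single (0 : Fin (d + 1)) 2)) h
  rw [sumOfSquares, map_sum, Finset.sum_eq_single 0] at h1
  · simp [MvPowerSeries.coeff_X_pow] at h1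
  · intro i _ hi
    rw [MvPowerSeries.coeff_X_pow, if_neg]
    intro h
    have := DFunLike.congr_fun h i
    simp [hi.symm] at this
  · simp

end HilbertKunz

theorem mainTheorem2 (p : ℕ) [Fact p.Prime] (hp : p ≠ 2)
    (k : Type*) [Field k] [CharP k p] [IsAlgClosed k] [Uncountable k]
    (d : ℕ) (f : MvPowerSeries (Fin (d + 1)) k) (hf : f ≠ 0)
    [IsLocalRing (HypersurfaceRing f)]
    (hsing : ¬ IsRegularLocalRing (HypersurfaceRing f)) :
    HilbertKunzLimitExists p (HypersurfaceRing (sumOfSquares k d)) ∧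
    HilbertKunzLimitExists p (HypersurfaceRing f) ∧
    hilbertKunzMultiplicity p (HypersurfaceRing (sumOfSquares k d)) ≤
      hilbertKunzMultiplicity p (HypersurfaceRing f) := by
  have hS := hilbertKunzLimitExists_hypersurface p (sumOfSquares_ne_zero (k := k) (d := d))
  have hR := hilbertKunzLimitExists_hypersurface p hf
  refine ⟨hS, hR, le_of_tendsto_of_tendsto' hS hR fun e => ?_⟩
  rw [hilbertKunzSeq_hypersurface p hf, hilbertKunzSeq_hypersurface p sumOfSquares_ne_zero]
  have h2 : (2 : k) ≠ 0 := by
    intro h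
    have h' : ((2 : ℕ) : k) = 0 := by exact_mod_cast h
    rw [CharP.cast_eq_zero_iff k p] at h'
    exact hp ((Nat.prime_dvd_prime_iff_eq Fact.out Nat.prime_two).1 h')
  obtain ⟨a, ha⟩ := exists_eq_sum_mul_X_mul_X hf hsing
  have h := truncColength_sum_sq_le h2 p e a
  rw [← ha] at h
  gcongr
  exact h
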